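/- Let $\lambda\in(0,1)$ and $d\in(0,1-\lambda)$. Let $\lfloor x\rfloor$ and $\{x\}=x-\lfloor x\rfloor$ be the integer and fractional parts of $x$, and for $a,z\in\mathbb R$ let $\theta_a(z)=0$ if $z<a$ and $\theta_a(z)=1$ if $z\ge a$. For $\delta\in(1-\lambda-d,1)$ and $a\in[0,1]$ let \[F_{\delta,a}(x)=\lambda x+\delta+(1-\lambda)\lfloor x\rfloor+d\,\theta_a(\{x\})\quad(x\in\mathbb R),\qquad f_{\delta,a}:[0,1)\to[0,1),\quad f_{\delta,a}(x)=\{F_{\delta,a}(x)\}.\] The rotation number of a map $g:[0,1)\to[0,1)$ that has a strictly increasing lift $G:\mathbb R\to\mathbb R$ (that is, $G(x+1)=G(x)+1$ for all $x\in\mathbb R$ and $\{G(x)\}=g(x)$ for $x\in[0,1)$) is $\{\lim_{n\to\infty}G^n(x)/n\}\in[0,1)$, provided that the limit exists and does not depend on $x\in\mathbb R$. For $\rho,\alpha\in[0,1]$ let \[\delta(\rho,\alpha)=1-\lambda-d+\frac{1-\lambda}{\lambda}\sum_{k=1}^{\infty}\lambda^k\bigl((1-\lambda)\lfloor k\rho\rfloor+d\,\theta_{1-\alpha}(\{k\rho\})\bigr),\]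 \[a(\delta,\rho,\alpha)=\frac{\delta}{1-\lambda}+\frac1\lambda\sum_{k=1}^{\infty}\lambda^k\bigl((1-\lambda)\lfloor\alpha-k\rho\rfloor+d\,\theta_\alpha(\{\alpha-k\rho\})\bigr),\] and for $\rho\in(0,1)$ let \[\mathcal P_{\rho,\alpha}=\{(\delta,a)\in\mathbb R^2:\ \delta\in[\delta(\rho^-,\alpha),\delta(\rho,\alpha)]\ \text{and}\ a\in[a(\delta,\rho^+,\alpha),a(\delta,\rho,\alpha)]\},\] where $\delta(\rho^-,\alpha)=\lim_{r\to\rho^-}\delta(r,\alpha)$ and $a(\delta,\rho^+,\alpha)=\lim_{r\to\rho^+}a(\delta,r,\alpha)$. For every $\delta\in(1-\lambda-d,1)$ and $a\in[0,1]$ the map $f_{\delta,a}$ has a well-defined (existing and unique) rotation number, and: 1. For every $\delta\in(1-\lambda-d,1)$, $a\in[0,1]$ and $\rho\in(0,1)$, the rotation number of $f_{\delta,a}$ is $\rho$ if and only if $(\delta,a)\in\bigcup_{\alpha\in[0,1]}\mathcal P_{\rho,\alpha}$. 2. The set $\{(\delta,a)\in(1-\lambda-d,1)\times[0,1]:\ \text{the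 rotation number of } f_{\delta,a}\text{ is irrational}\}$ is Lebesgue measurable in $\mathbb R^2$. -/

import Mathlib

open Set Filter Topology MeasureTheory

noncomputable section

namespace PWContraction

/-- The step function `θ_a`: `0` for `z < a` and `1` for `z ≥ a`. -/
def theta (a z : ℝ) : ℝ := if z < a then 0 else 1

/-- The map `F(x) = λ x + δ + (1 - λ) ⌊x⌋ + d θ_a({x})` of the real line. -/
def bigF (lam d δ a x : ℝ) : ℝ :=
  lam * x + δ + (1 - lam) * (⌊x⌋ : ℝ) + d * theta a (Int.fract x)

/-- The interval map `f_{δ,a} : [0,1) → [0,1)`, `f_{δ,a}(x) = F(x) mod 1`. -/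
def f (lam d δ a : ℝ) (x : Ico (0 : ℝ) 1) : Ico (0 : ℝ) 1 :=
  ⟨Int.fract (bigF lam d δ a x), Int.fract_nonneg _, Int.fract_lt_one _⟩

/-- `G` is an increasing degree-one lift to the real line of the map `g` of
`[0,1)`, seen as the circle. (Such a lift is unique up to adding an integer.) -/
structure IsIncreasingLift (G : ℝ → ℝ) (g : Ico (0 : ℝ) 1 → Ico (0 : ℝ) 1) : Prop where
  strictMono : StrictMono G
  map_add_one : ∀ x, G (x + 1) = G x + 1
  fract_eq : ∀ x : Ico (0 : ℝ) 1, Int.fract (G x) = (g x : ℝ)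

/-- The rotation number of `g` is `ρ`: `g` has an increasing lift `G` for which
`lim G^n(x) / n` exists, does not depend on `x`, and is equal to `ρ` modulo `1`, the
representative `ρ` being taken in `[0,1)`. -/
def HasRotationNumber (g : Ico (0 : ℝ) 1 → Ico (0 : ℝ) 1) (ρ : ℝ) : Prop :=
  ∃ G : ℝ → ℝ, IsIncreasingLift G g ∧
    ∃ L : ℝ, (∀ x : ℝ, Tendsto (fun n : ℕ => G^[n] x / (n : ℝ)) atTop (𝓝 L)) ∧
      Int.fract L = ρ

/-- The function `δ(ρ, α)`; the summation index is `k + 1` with `k ≥ 0`. -/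
def deltaFun (lam d ρ α : ℝ) : ℝ :=
  1 - lam - d + (1 - lam) / lam * ∑' k : ℕ, lam ^ (k + 1) *
    ((1 - lam) * (⌊((k + 1 : ℕ) : ℝ) * ρ⌋ : ℝ)
      + d * theta (1 - α) (Int.fract (((k + 1 : ℕ) : ℝ) * ρ)))

/-- The function `a(δ, ρ, α)`; the summation index is `k + 1` with `k ≥ 0`. -/
def aFun (lam d δ ρ α : ℝ) : ℝ :=
  δ / (1 - lam) + 1 / lam * ∑' k : ℕ, lam ^ (k + 1) *
    ((1 - lam) * (⌊α - ((k + 1 : ℕ) : ℝ) * ρ⌋ : ℝ)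
      + d * theta α (Int.fract (α - ((k + 1 : ℕ) : ℝ) * ρ)))

/-- The region `P_{ρ,α}` of the pairs `(δ, a)` with `δ ∈ [δ(ρ⁻, α), δ(ρ, α)]` and
`a ∈ [a(δ, ρ⁺, α), a(δ, ρ, α)]`, where `ρ⁻` and `ρ⁺` denote one-sided limits in `ρ`. -/
def region (lam d ρ α : ℝ) : Set (ℝ × ℝ) :=
  {p | p.1 ∈ Icc (Function.leftLim (fun r => deltaFun lam d r α) ρ) (deltaFun lam d ρ α) ∧
    p.2 ∈ Icc (Function.rightLim (fun r => aFun lam d p.1 r α) ρ) (aFun lam d p.1 ρ α)}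

end PWContraction

end

/-!
The lift `F` of `f_{δ,a}` can be written `F x = λ x + δ + d + (1 - λ - d) ⌊x⌋ + d ⌊x - a⌋`, and the
rotation number of `f_{δ,a}` is the fractional part of the translation number `τ(F) ∈ [0, 1]`. This
settles existence and uniqueness, as well as measurability, `τ(F)` being a pointwise limit of
functions that are measurable in `(δ, a)`.

For given `ρ` and `α`, iterating `h (y + ρ) = λ h y + δ + d + (1 - λ - d) ⌊y⌋ + d ⌊y - α⌋` backwards
determines a monotone degree one function `h = h_{ρ,α}`, a convergent series of floors, with
left-continuous version `h⁻`. The point `(δ, a)` lies in the region `P_{ρ,α}` exactly when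
`h⁻ 0 ≤ 0 ≤ h 0` and `h⁻ α ≤ a ≤ h α` (`mem_region_iff`).

The inequalities `0 ≤ h 0` and `a ≤ h α` give `h (y + ρ) ≤ F (h y)`, hence `ρ ≤ τ(F)`; the
inequalities for `h⁻` give `τ(F) ≤ ρ` in the same way. So the rotation number is `ρ` on `P_{ρ,α}`.

Conversely, let `τ(F) = ρ`. By semicontinuity in `ρ`, strict inequalities `h 0 < 0` and `h α < a`
persist for some `ρ' < ρ`, and force `τ(F) ≤ ρ' < ρ`; so they cannot both hold, and neither can
`0 < h⁻ 0` and `a < h⁻ α`. As `α` increases, `h 0` and `h⁻ 0` decrease while `h α` and `h⁻ α`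
increase, all four semicontinuously, and a suitable `α` is obtained as a supremum
(`exists_mem_region`).
-/

namespace PWContraction

/-! ### The lift and its rotation number -/

theorem floor_add_theta {α : ℝ} (hα : α ∈ Icc (0 : ℝ) 1) (z : ℝ) :
    (⌊z⌋ : ℝ) + theta (1 - α) (Int.fract z) = ⌊z + α⌋ := by
  have h0 := Int.fract_nonneg z
  have h1 := Int.fract_lt_one z
  have h2 := Int.floor_add_fract z
  unfold theta
  split_ifs with h
  · have : ⌊z + α⌋ = ⌊z⌋ := by
      rw [Int.floor_eq_iff]; constructor <;> linarith [hα.1]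
    rw [this]; ring
  · have : ⌊z + α⌋ = ⌊z⌋ + 1 := by
      rw [Int.floor_eq_iff]; push_cast; constructor <;> linarith [hα.2]
    rw [this]; push_cast; ring

/-- The lift `F` as an element of Mathlib's monoid of degree one lifts. The jump at `a` is written
with `⌊x - a⌋`, which makes sense for every real `a` and agrees with `bigF` for `a ∈ [0, 1]`. -/
noncomputable def circleLift {lam d : ℝ} (hlam : lam ∈ Ioo (0 : ℝ) 1)
    (hd : d ∈ Ioo (0 : ℝ) (1 - lam)) (δ a : ℝ) : CircleDeg1Lift where
  toFun x := lam * x + δ + d + (1 - lam - d) * ⌊x⌋ + d * ⌊x - a⌋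
  monotone' x y hxy := by
    have h1 : (⌊x⌋ : ℝ) ≤ ⌊y⌋ := by exact_mod_cast Int.floor_le_floor hxy
    have h2 : (⌊x - a⌋ : ℝ) ≤ ⌊y - a⌋ := by
      exact_mod_cast Int.floor_le_floor (sub_le_sub_right hxy a)
    have h3 := mul_le_mul_of_nonneg_left h1 (sub_nonneg.2 hd.2.le)
    have h4 := mul_le_mul_of_nonneg_left h2 hd.1.le
    have h5 := mul_le_mul_of_nonneg_left hxy hlam.1.le
    dsimp only
    linarith
  map_add_one' x := by
    have : x + 1 - a = x - a + 1 := by ring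
    rw [this, Int.floor_add_one, Int.floor_add_one]
    push_cast
    ring

variable {lam d : ℝ} {hlam : lam ∈ Ioo (0 : ℝ) 1} {hd : d ∈ Ioo (0 : ℝ) (1 - lam)}

theorem circleLift_apply (δ a x : ℝ) : circleLift hlam hd δ a x =
    lam * x + δ + d + (1 - lam - d) * ⌊x⌋ + d * ⌊x - a⌋ := rfl

theorem circleLift_strictMono (δ a : ℝ) : StrictMono (circleLift hlam hd δ a) := by
  intro x y hxy
  have h1 : (⌊x⌋ : ℝ) ≤ ⌊y⌋ := by exact_mod_cast Int.floor_le_floor hxy.le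
  have h2 : (⌊x - a⌋ : ℝ) ≤ ⌊y - a⌋ := by
    exact_mod_cast Int.floor_le_floor (sub_le_sub_right hxy.le a)
  have h3 := mul_le_mul_of_nonneg_left h1 (sub_nonneg.2 hd.2.le)
  have h4 := mul_le_mul_of_nonneg_left h2 hd.1.le
  have h5 := mul_lt_mul_of_pos_left hxy hlam.1
  rw [circleLift_apply, circleLift_apply]
  linarith

theorem circleLift_eq_bigF {a : ℝ} (ha : a ∈ Icc (0 : ℝ) 1) (δ x : ℝ) :
    circleLift hlam hd δ a x = bigF lam d δ a x := by
  have h := floor_add_theta (α := 1 - a) ⟨by linarith [ha.2], by linarith [ha.1]⟩ x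
  have h' : x + (1 - a) = x - a + 1 := by ring
  rw [sub_sub_cancel, h', Int.floor_add_one] at h
  push_cast at h
  rw [circleLift_apply, bigF]
  linear_combination -d * h

theorem isIncreasingLift_circleLift {a : ℝ} (ha : a ∈ Icc (0 : ℝ) 1) (δ : ℝ) :
    IsIncreasingLift (circleLift hlam hd δ a) (f lam d δ a) where
  strictMono := circleLift_strictMono δ a
  map_add_one := (circleLift hlam hd δ a).map_add_one
  fract_eq x := by rw [circleLift_eq_bigF ha]; rfl

/-- Two increasing lifts of the same map differ by an integer translation: their difference is
integer valued and periodic, and it cannot decrease over a distance less than `1`. -/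
theorem IsIncreasingLift.exists_eq_add_int {G H : ℝ → ℝ} {g : Ico (0 : ℝ) 1 → Ico (0 : ℝ) 1}
    (hG : IsIncreasingLift G g) (hH : IsIncreasingLift H g) :
    ∃ m : ℤ, ∀ x, G x = H x + m := by
  have key : ∀ x ∈ Ico (0 : ℝ) 1, ∃ m : ℤ, G x - H x = m := fun x hx => by
    obtain ⟨m, hm⟩ := Int.fract_eq_fract.1 ((hG.fract_eq ⟨x, hx⟩).trans (hH.fract_eq ⟨x, hx⟩).symm)
    exact ⟨m, hm⟩
  obtain ⟨m, hm⟩ := key 0 (by simp)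
  have hG1 := hG.map_add_one 0
  have hH1 := hH.map_add_one 0
  rw [zero_add] at hG1 hH1
  have on_Ico : ∀ x ∈ Ico (0 : ℝ) 1, G x - H x = m := by
    intro x hx
    obtain ⟨n, hn⟩ := key x hx
    rw [hn]
    have a1 := hG.strictMono.monotone hx.1
    have a2 := hH.strictMono.monotone hx.1
    have a3 := hG.strictMono hx.2
    have a4 := hH.strictMono hx.2
    have b1 : (n : ℝ) < m + 1 := by linarith
    have b2 : (m : ℝ) < n + 1 := by linarith
    have b1' : n < m + 1 := by exact_mod_cast b1
    have b2' : m < n + 1 := by exact_mod_cast b2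
    have : n = m := by omega
    rw [this]
  have hper : Function.Periodic (fun x => G x - H x) 1 := fun x => by
    simp only [hG.map_add_one, hH.map_add_one]; ring
  refine ⟨m, fun x => ?_⟩
  have h1 := hper.sub_int_mul_eq (x := x) ⌊x⌋
  have h2 := on_Ico (Int.fract x) ⟨Int.fract_nonneg x, Int.fract_lt_one x⟩
  simp only [mul_one, Int.self_sub_floor] at h1
  linarith

theorem tendsto_iterate_div (F : CircleDeg1Lift) (x : ℝ) :
    Tendsto (fun n : ℕ => F^[n] x / (n : ℝ)) atTop (𝓝 F.translationNumber) := by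
  have h := (F.tendsto_translationNumber x).add (tendsto_const_div_atTop_nhds_zero_nat x)
  rw [add_zero] at h
  refine h.congr fun n => ?_
  rw [CircleDeg1Lift.coe_pow]
  ring

theorem hasRotationNumber_iff {a : ℝ} (ha : a ∈ Icc (0 : ℝ) 1) (δ ρ : ℝ) :
    HasRotationNumber (f lam d δ a) ρ ↔
      Int.fract (circleLift hlam hd δ a).translationNumber = ρ := by
  constructor
  · rintro ⟨G, hG, L, hL, rfl⟩
    obtain ⟨m, hm⟩ := hG.exists_eq_add_int
      (isIncreasingLift_circleLift (hlam := hlam) (hd := hd) ha δ)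
    have hGF : G = ⇑((CircleDeg1Lift.translate (Multiplicative.ofAdd (m : ℝ)) : CircleDeg1Lift) *
        circleLift hlam hd δ a) := by
      funext x
      rw [hm, CircleDeg1Lift.mul_apply, CircleDeg1Lift.translate_apply, add_comm]
    have h1 := hL 0
    rw [hGF] at h1
    have h2 := tendsto_nhds_unique h1 (tendsto_iterate_div _ 0)
    have hcomm : Commute
        (CircleDeg1Lift.translate (Multiplicative.ofAdd (m : ℝ)) : CircleDeg1Lift)
        (circleLift hlam hd δ a) := by
      ext x
      simp [CircleDeg1Lift.mul_apply, CircleDeg1Lift.translate_apply]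
    rw [CircleDeg1Lift.translationNumber_mul_of_commute hcomm,
      CircleDeg1Lift.translationNumber_translate] at h2
    rw [h2, add_comm, Int.fract_add_intCast]
  · rintro rfl
    exact ⟨_, isIncreasingLift_circleLift ha δ, _, tendsto_iterate_div _, rfl⟩

theorem le_translationNumber_of_le {F : CircleDeg1Lift} {h : ℝ → ℝ} (hmono : Monotone h)
    (hone : ∀ (y : ℝ) (m : ℤ), h (y + m) = h y + m) {ρ : ℝ} (hF : ∀ y, h (y + ρ) ≤ F (h y)) :
    ρ ≤ F.translationNumber := by
  have iter : ∀ n : ℕ, h (n * ρ) ≤ F^[n] (h 0) := by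
    intro n
    induction n with
    | zero => simp
    | succ n ih =>
      rw [Function.iterate_succ_apply']
      refine le_trans ?_ (F.monotone ih)
      have := hF (n * ρ)
      push_cast
      rwa [add_mul, one_mul]
  have lim : Tendsto (fun n : ℕ => ρ + (h 0 - 1) / (n : ℝ)) atTop (𝓝 ρ) := by
    simpa using tendsto_const_nhds.add (tendsto_const_div_atTop_nhds_zero_nat (h 0 - 1))
  refine le_of_tendsto_of_tendsto lim (tendsto_iterate_div F (h 0)) ?_
  filter_upwards [eventually_gt_atTop 0] with n hn
  have hn' : (0 : ℝ) < n := by exact_mod_cast hn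
  rw [le_div_iff₀ hn', add_mul, div_mul_cancel₀ _ hn'.ne']
  have h1 := hmono (Int.floor_le (n * ρ))
  have h2 := hone 0 ⌊n * ρ⌋
  rw [zero_add] at h2
  linarith [iter n, Int.lt_floor_add_one (n * ρ)]

theorem translationNumber_le_of_lt {F : CircleDeg1Lift} {h : ℝ → ℝ} (hmono : Monotone h)
    (hone : ∀ (y : ℝ) (m : ℤ), h (y + m) = h y + m) {ρ : ℝ}
    (hF : ∀ y z, z < h y → F z < h (y + ρ)) : F.translationNumber ≤ ρ := by
  have iter : ∀ n : ℕ, F^[n] (h 0 - 1) < h (n * ρ) := by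
    intro n
    induction n with
    | zero => simp
    | succ n ih =>
      rw [Function.iterate_succ_apply']
      have := hF _ _ ih
      push_cast
      rwa [add_mul, one_mul]
  have lim : Tendsto (fun n : ℕ => ρ + (h 0 + 1) / (n : ℝ)) atTop (𝓝 ρ) := by
    simpa using tendsto_const_nhds.add (tendsto_const_div_atTop_nhds_zero_nat (h 0 + 1))
  refine le_of_tendsto_of_tendsto (tendsto_iterate_div F (h 0 - 1)) lim ?_
  filter_upwards [eventually_gt_atTop 0] with n hn
  have hn' : (0 : ℝ) < n := by exact_mod_cast hn
  rw [div_le_iff₀ hn', add_mul, div_mul_cancel₀ _ hn'.ne']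
  have h1 := hmono (Int.le_ceil (n * ρ))
  have h2 := hone 0 ⌈n * ρ⌉
  rw [zero_add] at h2
  linarith [iter n, Int.ceil_lt_add_one (n * ρ)]

theorem translationNumber_circleLift_mem_Icc {δ a : ℝ} (hδ : δ ∈ Ioo (1 - lam - d) 1)
    (ha : a ∈ Icc (0 : ℝ) 1) : (circleLift hlam hd δ a).translationNumber ∈ Icc (0 : ℝ) 1 := by
  have hl := hlam.1
  have hl' := hlam.2
  have hd0 := hd.1
  have hd1 := hd.2
  constructor
  · refine le_translationNumber_of_le (h := fun y => (⌊y⌋ : ℝ))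
      (fun x y hxy => Int.cast_le.2 (Int.floor_le_floor hxy))
      (fun y m => by rw [Int.floor_add_intCast]; push_cast; rfl) fun y => ?_
    have h0 : (-1 : ℝ) ≤ ⌊0 - a⌋ := by
      have : (-1 : ℤ) ≤ ⌊0 - a⌋ := Int.le_floor.2 (by push_cast; linarith [ha.2])
      exact_mod_cast this
    have h1 := (circleLift hlam hd δ a).map_add_int 0 ⌊y⌋
    rw [zero_add] at h1
    rw [add_zero, h1, circleLift_apply]
    simp only [mul_zero, Int.floor_zero, Int.cast_zero]
    nlinarith [mul_le_mul_of_nonneg_left h0 hd0.le, hδ.1]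
  · refine translationNumber_le_of_lt (h := fun y => (⌈y⌉ : ℝ))
      (fun x y hxy => Int.cast_le.2 (Int.ceil_le_ceil hxy))
      (fun y m => by rw [Int.ceil_add_intCast]; push_cast; rfl) fun y z hz => ?_
    have h1 : (⌊z⌋ : ℝ) ≤ ⌈y⌉ - 1 := by
      have : ⌊z⌋ < ⌈y⌉ := Int.floor_lt.2 hz
      exact_mod_cast Int.le_sub_one_of_lt this
    have h2 : (⌊z - a⌋ : ℝ) ≤ ⌈y⌉ - 1 :=
      le_trans (Int.cast_le.2 (Int.floor_le_floor (by linarith [ha.1]))) h1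
    rw [Int.ceil_add_one, circleLift_apply]
    push_cast
    linarith [mul_lt_mul_of_pos_left hz hl, hδ.2, mul_le_mul_of_nonneg_left h2 hd0.le,
      mul_le_mul_of_nonneg_left h1 (sub_nonneg.2 hd1.le)]

theorem measurable_translationNumber_circleLift :
    Measurable fun p : ℝ × ℝ => (circleLift hlam hd p.1 p.2).translationNumber := by
  have hF : Measurable fun q : (ℝ × ℝ) × ℝ => circleLift hlam hd q.1.1 q.1.2 q.2 := by
    simp only [circleLift_apply]
    have h1 : Measurable fun q : (ℝ × ℝ) × ℝ => ((⌊q.2⌋ : ℤ) : ℝ) :=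
      measurable_from_top.comp (Int.measurable_floor.comp (by fun_prop))
    have h2 : Measurable fun q : (ℝ × ℝ) × ℝ => ((⌊q.2 - q.1.2⌋ : ℤ) : ℝ) :=
      measurable_from_top.comp (Int.measurable_floor.comp (by fun_prop))
    fun_prop
  have iter : ∀ n : ℕ, Measurable fun p : ℝ × ℝ => (circleLift hlam hd p.1 p.2)^[n] 0 := by
    intro n
    induction n with
    | zero => simp
    | succ n ih =>
      simp only [Function.iterate_succ_apply']
      exact hF.comp (measurable_id.prodMk ih)
  refine measurable_of_tendsto_metrizable (fun n => (iter n).div_const (n : ℝ)) ?_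
  rw [tendsto_pi_nhds]
  exact fun p => tendsto_iterate_div _ 0

end PWContraction

namespace PWContraction

variable {lam d : ℝ} (hlam : lam ∈ Ioo (0 : ℝ) 1) (hd : d ∈ Ioo (0 : ℝ) (1 - lam))

/-! ### The floor series and its ceiling variant -/

/-- `∑ λᵏ ((1 - λ - d) ⌊u - (k+1) ρ⌋ + d ⌊v - (k+1) ρ⌋)` over `k ≥ 0`: up to an additive constant,
the value at a point of the solution `h` of `F (h y) = h (y + ρ)`, where `u` and `v` are the
distances from that point to the two points which `h` sends to the discontinuities `0` and `a`
of `F`. -/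
noncomputable def floorSeries (lam d ρ u v : ℝ) : ℝ :=
  ∑' k : ℕ, lam ^ k * ((1 - lam - d) * ⌊u - ((k + 1 : ℕ) : ℝ) * ρ⌋
    + d * ⌊v - ((k + 1 : ℕ) : ℝ) * ρ⌋)

/-- The variant of `floorSeries` with the left-continuous function `⌈x⌉ - 1 = -⌊-x⌋ - 1` in place
of `⌊x⌋`; the constant is right because `∑ λᵏ (1 - λ) = 1`. -/
noncomputable def ceilSeries (lam d ρ u v : ℝ) : ℝ :=
  -1 - floorSeries lam d (-ρ) (-u) (-v)

theorem abs_floor_le (x : ℝ) : |(⌊x⌋ : ℝ)| ≤ |x| + 1 := by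
  rw [abs_le]
  constructor
  · linarith [Int.lt_floor_add_one x, neg_abs_le x]
  · linarith [Int.floor_le x, le_abs_self x]

include hlam in
theorem summable_pow_mul_affine (p q : ℝ) : Summable fun k : ℕ => lam ^ k * (p * k + q) := by
  have hn : ‖lam‖ < 1 := by rw [Real.norm_eq_abs, abs_of_pos hlam.1]; exact hlam.2
  have h1 := (summable_pow_mul_geometric_of_norm_lt_one 1 hn).mul_left p
  have h2 := (summable_geometric_of_lt_one hlam.1.le hlam.2).mul_left q
  refine (h1.add h2).congr fun k => ?_
  ring

include hlam hd in
theorem norm_term_le {ρ u v R U V : ℝ} (hρ : |ρ| ≤ R) (hu : |u| ≤ U) (hv : |v| ≤ V) (k : ℕ) :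
    ‖lam ^ k * ((1 - lam - d) * ⌊u - ((k + 1 : ℕ) : ℝ) * ρ⌋
      + d * ⌊v - ((k + 1 : ℕ) : ℝ) * ρ⌋)‖ ≤ lam ^ k * (2 * R * k + (2 * R + U + V + 2)) := by
  have hl := hlam.1
  have hd0 := hd.1
  have hd1 := hd.2
  rw [norm_mul, Real.norm_eq_abs, Real.norm_eq_abs, abs_of_pos (pow_pos hl k)]
  refine mul_le_mul_of_nonneg_left ?_ (pow_pos hl k).le
  have key : ∀ w W : ℝ, |w| ≤ W → |(⌊w - ((k + 1 : ℕ) : ℝ) * ρ⌋ : ℝ)| ≤ R * k + (R + W + 1) := by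
    intro w W hw
    have h1 := abs_floor_le (w - ((k + 1 : ℕ) : ℝ) * ρ)
    have h2 := abs_sub w (((k + 1 : ℕ) : ℝ) * ρ)
    rw [abs_mul, Nat.abs_cast] at h2
    have h3 : ((k + 1 : ℕ) : ℝ) * |ρ| ≤ ((k + 1 : ℕ) : ℝ) * R :=
      mul_le_mul_of_nonneg_left hρ (Nat.cast_nonneg _)
    push_cast at h1 h2 h3 ⊢
    linarith
  have k1 := key u U hu
  have k2 := key v V hv
  refine (abs_add_le _ _).trans ?_
  rw [abs_mul, abs_mul, abs_of_pos hd0, abs_of_pos (sub_pos.2 hd1)]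
  have e1 : (1 - lam - d) * |(⌊u - ((k + 1 : ℕ) : ℝ) * ρ⌋ : ℝ)| ≤
      |(⌊u - ((k + 1 : ℕ) : ℝ) * ρ⌋ : ℝ)| :=
    mul_le_of_le_one_left (abs_nonneg _) (by linarith)
  have e2 : d * |(⌊v - ((k + 1 : ℕ) : ℝ) * ρ⌋ : ℝ)| ≤ |(⌊v - ((k + 1 : ℕ) : ℝ) * ρ⌋ : ℝ)| :=
    mul_le_of_le_one_left (abs_nonneg _) (by linarith)
  linarith

include hlam hd in
theorem summable_floorSeries (ρ u v : ℝ) :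
    Summable fun k : ℕ => lam ^ k * ((1 - lam - d) * ⌊u - ((k + 1 : ℕ) : ℝ) * ρ⌋
      + d * ⌊v - ((k + 1 : ℕ) : ℝ) * ρ⌋) :=
  Summable.of_norm_bounded (summable_pow_mul_affine hlam _ _)
    (norm_term_le hlam hd le_rfl le_rfl le_rfl)

include hlam hd in
theorem floorSeries_mono {ρ ρ' u u' v v' : ℝ} (hρ : ρ' ≤ ρ) (hu : u ≤ u') (hv : v ≤ v') :
    floorSeries lam d ρ u v ≤ floorSeries lam d ρ' u' v' := by
  refine (summable_floorSeries hlam hd ρ u v).tsum_le_tsum (fun k => ?_)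
    (summable_floorSeries hlam hd ρ' u' v')
  refine mul_le_mul_of_nonneg_left ?_ (pow_pos hlam.1 k).le
  have h := mul_le_mul_of_nonneg_left hρ (Nat.cast_nonneg (α := ℝ) (k + 1))
  exact add_le_add
    (mul_le_mul_of_nonneg_left (Int.cast_le.2 (Int.floor_le_floor (by linarith)))
      (sub_nonneg.2 hd.2.le))
    (mul_le_mul_of_nonneg_left (Int.cast_le.2 (Int.floor_le_floor (by linarith))) hd.1.le)

include hlam hd in
/-- The functional equation behind `F (h y) = h (y + ρ)`. -/
theorem floorSeries_add_self (ρ u v : ℝ) : floorSeries lam d ρ (u + ρ) (v + ρ) =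
    (1 - lam - d) * ⌊u⌋ + d * ⌊v⌋ + lam * floorSeries lam d ρ u v := by
  rw [floorSeries, (summable_floorSeries hlam hd ρ _ _).tsum_eq_zero_add,
    floorSeries, ← tsum_mul_left]
  congr 1
  · simp
  · refine tsum_congr fun k => ?_
    have h : ∀ w : ℝ, w + ρ - ((k + 1 + 1 : ℕ) : ℝ) * ρ = w - ((k + 1 : ℕ) : ℝ) * ρ := fun w => by
      push_cast; ring
    rw [h, h]
    ring

include hlam hd in
theorem floorSeries_add_int (ρ u v : ℝ) (m n : ℤ) : floorSeries lam d ρ (u + m) (v + n) =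
    floorSeries lam d ρ u v + ((1 - lam - d) * m + d * n) / (1 - lam) := by
  have h1 := (summable_geometric_of_lt_one hlam.1.le hlam.2).mul_right
    ((1 - lam - d) * (m : ℝ) + d * n)
  rw [div_eq_inv_mul, ← tsum_geometric_of_lt_one hlam.1.le hlam.2, ← tsum_mul_right, floorSeries,
    floorSeries, ← (summable_floorSeries hlam hd ρ u v).tsum_add h1]
  refine tsum_congr fun k => ?_
  rw [add_sub_right_comm, add_sub_right_comm, Int.floor_add_intCast, Int.floor_add_intCast]
  push_cast
  ring

include hlam hd in
theorem ceilSeries_mono {ρ ρ' u u' v v' : ℝ} (hρ : ρ' ≤ ρ) (hu : u ≤ u') (hv : v ≤ v') :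
    ceilSeries lam d ρ u v ≤ ceilSeries lam d ρ' u' v' :=
  sub_le_sub_left (floorSeries_mono hlam hd (neg_le_neg hρ) (neg_le_neg hu)
    (neg_le_neg hv)) _

include hlam hd in
theorem ceilSeries_add_self (ρ u v : ℝ) : ceilSeries lam d ρ (u + ρ) (v + ρ) =
    (1 - lam - d) * (⌈u⌉ - 1) + d * (⌈v⌉ - 1) + lam * ceilSeries lam d ρ u v := by
  rw [ceilSeries, neg_add, neg_add, floorSeries_add_self hlam hd, ceilSeries,
    Int.floor_neg, Int.floor_neg]
  push_cast
  ring

include hlam hd in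
theorem ceilSeries_add_int (ρ u v : ℝ) (m n : ℤ) : ceilSeries lam d ρ (u + m) (v + n) =
    ceilSeries lam d ρ u v + ((1 - lam - d) * m + d * n) / (1 - lam) := by
  have h := floorSeries_add_int hlam hd (-ρ) (-u) (-v) (-m) (-n)
  push_cast at h
  rw [ceilSeries, neg_add, neg_add, h, ceilSeries]
  ring

include hlam hd in
theorem tendsto_floorSeries {ι : Type*} {l : Filter ι} {r u v : ι → ℝ} {r₀ u₀ v₀ : ℝ}
    (hr : Tendsto r l (𝓝 r₀)) (hu : Tendsto u l (𝓝 u₀)) (hv : Tendsto v l (𝓝 v₀)) {m n : ℕ → ℤ}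
    (hm : ∀ k : ℕ, ∀ᶠ i in l, ⌊u i - ((k + 1 : ℕ) : ℝ) * r i⌋ = m k)
    (hn : ∀ k : ℕ, ∀ᶠ i in l, ⌊v i - ((k + 1 : ℕ) : ℝ) * r i⌋ = n k) :
    Tendsto (fun i => floorSeries lam d (r i) (u i) (v i)) l
      (𝓝 (∑' k : ℕ, lam ^ k * ((1 - lam - d) * m k + d * n k))) := by
  have bd : ∀ {w : ι → ℝ} {w₀ : ℝ}, Tendsto w l (𝓝 w₀) → ∀ᶠ i in l, |w i| ≤ |w₀| + 1 :=
    fun h => (h.abs.eventually_lt_const (lt_add_one _)).mono fun _ h => h.le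
  refine tendsto_tsum_of_dominated_convergence
    (summable_pow_mul_affine hlam (2 * (|r₀| + 1))
      (2 * (|r₀| + 1) + (|u₀| + 1) + (|v₀| + 1) + 2)) (fun k => ?_) ?_
  · refine tendsto_const_nhds.congr' ?_
    filter_upwards [hm k, hn k] with i h1 h2
    rw [h1, h2]
  · filter_upwards [bd hr, bd hu, bd hv] with i h1 h2 h3
    exact norm_term_le hlam hd h1 h2 h3

theorem eventually_floor_eq {ι : Type*} {l : Filter ι} {w : ι → ℝ} {w₀ : ℝ}
    (hw : Tendsto w l (𝓝 w₀)) (h : ∀ᶠ i in l, w₀ ≤ w i) : ∀ᶠ i in l, ⌊w i⌋ = ⌊w₀⌋ := by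
  filter_upwards [h, hw.eventually_lt_const (Int.lt_floor_add_one w₀)] with i h1 h2
  exact Int.floor_eq_iff.2 ⟨(Int.floor_le _).trans h1, h2⟩

theorem eventually_floor_eq_of_lt {ι : Type*} {l : Filter ι} {w : ι → ℝ} {w₀ : ℝ}
    (hw : Tendsto w l (𝓝 w₀)) (h : ∀ᶠ i in l, w i < w₀) : ∀ᶠ i in l, ⌊w i⌋ = -⌊-w₀⌋ - 1 := by
  have h0 : ((-⌊-w₀⌋ - 1 : ℤ) : ℝ) < w₀ := by
    push_cast; linarith [Int.lt_floor_add_one (-w₀)]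
  filter_upwards [h, hw.eventually_const_lt h0] with i h1 h2
  refine Int.floor_eq_iff.2 ⟨h2.le, h1.trans_le ?_⟩
  push_cast
  linarith [Int.floor_le (-w₀)]

include hlam hd in
theorem tendsto_floorSeries_right {ι : Type*} {l : Filter ι} {r u v : ι → ℝ} {r₀ u₀ v₀ : ℝ}
    (hr : Tendsto r l (𝓝 r₀)) (hu : Tendsto u l (𝓝 u₀)) (hv : Tendsto v l (𝓝 v₀))
    (hr' : ∀ᶠ i in l, r i ≤ r₀) (hu' : ∀ᶠ i in l, u₀ ≤ u i) (hv' : ∀ᶠ i in l, v₀ ≤ v i) :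
    Tendsto (fun i => floorSeries lam d (r i) (u i) (v i)) l (𝓝 (floorSeries lam d r₀ u₀ v₀)) := by
  refine tendsto_floorSeries hlam hd hr hu hv (fun k => ?_) fun k => ?_
  · refine eventually_floor_eq (hu.sub (hr.const_mul _)) ?_
    filter_upwards [hr', hu'] with i h1 h2
    exact sub_le_sub h2 (mul_le_mul_of_nonneg_left h1 (Nat.cast_nonneg _))
  · refine eventually_floor_eq (hv.sub (hr.const_mul _)) ?_
    filter_upwards [hr', hv'] with i h1 h2
    exact sub_le_sub h2 (mul_le_mul_of_nonneg_left h1 (Nat.cast_nonneg _))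

include hlam hd in
theorem tendsto_ceilSeries_left {ι : Type*} {l : Filter ι} {r u v : ι → ℝ} {r₀ u₀ v₀ : ℝ}
    (hr : Tendsto r l (𝓝 r₀)) (hu : Tendsto u l (𝓝 u₀)) (hv : Tendsto v l (𝓝 v₀))
    (hr' : ∀ᶠ i in l, r₀ ≤ r i) (hu' : ∀ᶠ i in l, u i ≤ u₀) (hv' : ∀ᶠ i in l, v i ≤ v₀) :
    Tendsto (fun i => ceilSeries lam d (r i) (u i) (v i)) l (𝓝 (ceilSeries lam d r₀ u₀ v₀)) :=
  (tendsto_floorSeries_right hlam hd hr.neg hu.neg hv.neg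
    (hr'.mono fun _ => neg_le_neg) (hu'.mono fun _ => neg_le_neg)
    (hv'.mono fun _ => neg_le_neg)).const_sub _

include hlam hd in
theorem tsum_ceil_eq_ceilSeries (ρ u v : ℝ) :
    ∑' k : ℕ, lam ^ k * ((1 - lam - d) * ((-⌊-(u - ((k + 1 : ℕ) : ℝ) * ρ)⌋ - 1 : ℤ) : ℝ)
      + d * ((-⌊-(v - ((k + 1 : ℕ) : ℝ) * ρ)⌋ - 1 : ℤ) : ℝ)) = ceilSeries lam d ρ u v := by
  have h1 : (-1 : ℝ) = ∑' k : ℕ, lam ^ k * (lam - 1) := by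
    rw [tsum_mul_right, tsum_geometric_of_lt_one hlam.1.le hlam.2]
    field_simp [(sub_pos.2 hlam.2).ne']
    ring
  rw [ceilSeries, floorSeries, h1,
    ← ((summable_geometric_of_lt_one hlam.1.le hlam.2).mul_right _).tsum_sub
      (summable_floorSeries hlam hd _ _ _)]
  refine tsum_congr fun k => ?_
  have h : ∀ w : ℝ, -(w - ((k + 1 : ℕ) : ℝ) * ρ) = -w - ((k + 1 : ℕ) : ℝ) * -ρ := fun w => by ring
  rw [h, h]
  push_cast
  ring

include hlam hd in
/-- A strict increase of `ρ` makes every argument of a floor strictly smaller, since the factor of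
`ρ` is at least `1`; hence the one-sided limit of the floor series is the ceiling series. -/
theorem tendsto_floorSeries_nhdsGT (ρ u v : ℝ) :
    Tendsto (fun r => floorSeries lam d r u v) (𝓝[>] ρ) (𝓝 (ceilSeries lam d ρ u v)) := by
  rw [← tsum_ceil_eq_ceilSeries hlam hd]
  have hr : Tendsto (fun r : ℝ => r) (𝓝[>] ρ) (𝓝 ρ) := tendsto_id.mono_left nhdsWithin_le_nhds
  have key : ∀ (w : ℝ) (k : ℕ), ∀ᶠ r in 𝓝[>] ρ, ⌊w - ((k + 1 : ℕ) : ℝ) * r⌋ =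
      -⌊-(w - ((k + 1 : ℕ) : ℝ) * ρ)⌋ - 1 := fun w k => by
    refine eventually_floor_eq_of_lt ((hr.const_mul _).const_sub _) ?_
    filter_upwards [self_mem_nhdsWithin] with r hr
    have := mul_lt_mul_of_pos_left hr (Nat.cast_pos (α := ℝ).2 k.succ_pos)
    exact sub_lt_sub_left this _
  exact tendsto_floorSeries hlam hd hr tendsto_const_nhds tendsto_const_nhds
    (key u) (key v)

include hlam hd in
theorem ceilSeries_le_floorSeries (ρ u v : ℝ) :
    ceilSeries lam d ρ u v ≤ floorSeries lam d ρ u v :=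
  le_of_tendsto (tendsto_floorSeries_nhdsGT hlam hd ρ u v)
    (by filter_upwards [self_mem_nhdsWithin] with r hr
        exact floorSeries_mono hlam hd (le_of_lt hr) le_rfl le_rfl)

end PWContraction

namespace PWContraction

variable {lam d : ℝ} (hlam : lam ∈ Ioo (0 : ℝ) 1) (hd : d ∈ Ioo (0 : ℝ) (1 - lam))

/-! ### Comparison of the rotation number with `ρ` -/

include hlam in
theorem const_eq (δ : ℝ) :
    (δ + d) / (1 - lam) = δ + d + lam * ((δ + d) / (1 - lam)) := by
  have : 1 - lam ≠ 0 := (sub_pos.2 hlam.2).ne'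
  field_simp
  ring

include hlam hd in
theorem floorSeries_add_int_self (ρ u v : ℝ) (m : ℤ) :
    floorSeries lam d ρ (u + m) (v + m) = floorSeries lam d ρ u v + m := by
  have : 1 - lam ≠ 0 := (sub_pos.2 hlam.2).ne'
  rw [floorSeries_add_int hlam hd]
  field_simp
  ring

include hlam hd in
theorem ceilSeries_add_int_self (ρ u v : ℝ) (m : ℤ) :
    ceilSeries lam d ρ (u + m) (v + m) = ceilSeries lam d ρ u v + m := by
  have : 1 - lam ≠ 0 := (sub_pos.2 hlam.2).ne'
  rw [ceilSeries_add_int hlam hd]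
  field_simp
  ring

/-- The hypotheses say that `h y = (δ + d) / (1 - λ) + floorSeries ρ y (y - α)` satisfies `0 ≤ h 0`
and `a ≤ h α`; hence `⌊y⌋ ≤ ⌊h y⌋` and `⌊y - α⌋ ≤ ⌊h y - a⌋`, so that `h (y + ρ) ≤ F (h y)`. -/
theorem le_translationNumber_circleLift {δ a ρ α : ℝ}
    (h0 : 0 ≤ (δ + d) / (1 - lam) + floorSeries lam d ρ 0 (-α))
    (ha : a ≤ (δ + d) / (1 - lam) + floorSeries lam d ρ α 0) :
    ρ ≤ (circleLift hlam hd δ a).translationNumber := by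
  have mono : Monotone fun y => (δ + d) / (1 - lam) + floorSeries lam d ρ y (y - α) :=
    fun x y hxy => add_le_add_right
      (floorSeries_mono hlam hd le_rfl hxy (sub_le_sub_right hxy α)) _
  have one : ∀ (y : ℝ) (m : ℤ), (δ + d) / (1 - lam) + floorSeries lam d ρ (y + m) (y + m - α) =
      (δ + d) / (1 - lam) + floorSeries lam d ρ y (y - α) + m := fun y m => by
    rw [add_sub_right_comm, floorSeries_add_int_self hlam hd, add_assoc]
  refine le_translationNumber_of_le mono one fun y => ?_
  have h1 : (⌊y⌋ : ℝ) ≤ ⌊(δ + d) / (1 - lam) + floorSeries lam d ρ y (y - α)⌋ := by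
    refine Int.cast_le.2 (Int.le_floor.2 ?_)
    have e1 := mono (Int.floor_le y)
    have e2 := one 0 ⌊y⌋
    simp only [zero_add, zero_sub] at e1 e2
    linarith
  have h2 : (⌊y - α⌋ : ℝ) ≤ ⌊(δ + d) / (1 - lam) + floorSeries lam d ρ y (y - α) - a⌋ := by
    refine Int.cast_le.2 (Int.le_floor.2 ?_)
    have e1 := mono (show α + ⌊y - α⌋ ≤ y by linarith [Int.floor_le (y - α)])
    have e2 := one α ⌊y - α⌋
    simp only [sub_self] at e1 e2
    linarith
  rw [circleLift_apply, add_sub_right_comm, floorSeries_add_self hlam hd]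
  linarith [const_eq (d := d) hlam δ, mul_le_mul_of_nonneg_left h1 (sub_nonneg.2 hd.2.le),
    mul_le_mul_of_nonneg_left h2 hd.1.le]

/-- The mirror image of `le_translationNumber_circleLift`, for the left-continuous function
`h y = (δ + d) / (1 - λ) + ceilSeries ρ y (y - α)`: here `z < h y` forces `F z < h (y + ρ)`. -/
theorem translationNumber_circleLift_le {δ a ρ α : ℝ}
    (h0 : (δ + d) / (1 - lam) + ceilSeries lam d ρ 0 (-α) ≤ 0)
    (ha : (δ + d) / (1 - lam) + ceilSeries lam d ρ α 0 ≤ a) :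
    (circleLift hlam hd δ a).translationNumber ≤ ρ := by
  have mono : Monotone fun y => (δ + d) / (1 - lam) + ceilSeries lam d ρ y (y - α) :=
    fun x y hxy => add_le_add_right
      (ceilSeries_mono hlam hd le_rfl hxy (sub_le_sub_right hxy α)) _
  have one : ∀ (y : ℝ) (m : ℤ), (δ + d) / (1 - lam) + ceilSeries lam d ρ (y + m) (y + m - α) =
      (δ + d) / (1 - lam) + ceilSeries lam d ρ y (y - α) + m := fun y m => by
    rw [add_sub_right_comm, ceilSeries_add_int_self hlam hd, add_assoc]
  refine translationNumber_le_of_lt mono one fun y z hz => ?_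
  have h1 : (⌊z⌋ : ℝ) ≤ ⌈y⌉ - 1 := by
    have : ⌊z⌋ < ⌈y⌉ := by
      refine Int.floor_lt.2 ?_
      have e1 := mono (Int.le_ceil y)
      have e2 := one 0 ⌈y⌉
      simp only [zero_add, zero_sub] at e1 e2
      linarith
    exact_mod_cast Int.le_sub_one_of_lt this
  have h2 : (⌊z - a⌋ : ℝ) ≤ ⌈y - α⌉ - 1 := by
    have : ⌊z - a⌋ < ⌈y - α⌉ := by
      refine Int.floor_lt.2 ?_
      have e1 := mono (show y ≤ α + ⌈y - α⌉ by linarith [Int.le_ceil (y - α)])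
      have e2 := one α ⌈y - α⌉
      simp only [sub_self] at e1 e2
      linarith
    exact_mod_cast Int.le_sub_one_of_lt this
  rw [circleLift_apply, add_sub_right_comm, ceilSeries_add_self hlam hd]
  linarith [const_eq (d := d) hlam δ, mul_le_mul_of_nonneg_left h1 (sub_nonneg.2 hd.2.le),
    mul_le_mul_of_nonneg_left h2 hd.1.le, mul_lt_mul_of_pos_left hz hlam.1]

/-- Strict inequalities persist for some `ρ' < ρ`, since the floor series is left-continuous
in `ρ`. -/
theorem translationNumber_circleLift_lt {δ a ρ α : ℝ}
    (h0 : (δ + d) / (1 - lam) + floorSeries lam d ρ 0 (-α) < 0)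
    (ha : (δ + d) / (1 - lam) + floorSeries lam d ρ α 0 < a) :
    (circleLift hlam hd δ a).translationNumber < ρ := by
  have hr : Tendsto (fun r : ℝ => r) (𝓝[<] ρ) (𝓝 ρ) := tendsto_id.mono_left nhdsWithin_le_nhds
  have hr' : ∀ᶠ r in 𝓝[<] ρ, r ≤ ρ := by
    filter_upwards [self_mem_nhdsWithin] with r hr using le_of_lt hr
  have lim : ∀ u v, Tendsto (fun r => (δ + d) / (1 - lam) + floorSeries lam d r u v) (𝓝[<] ρ)
      (𝓝 ((δ + d) / (1 - lam) + floorSeries lam d ρ u v)) := fun u v =>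
    (tendsto_floorSeries_right hlam hd hr tendsto_const_nhds tendsto_const_nhds hr'
      (.of_forall fun _ => le_rfl) (.of_forall fun _ => le_rfl)).const_add _
  obtain ⟨r, ⟨h1, h2⟩, h3⟩ := (((lim 0 (-α)).eventually_lt_const h0).and
    ((lim α 0).eventually_lt_const ha) |>.and self_mem_nhdsWithin).exists
  refine (translationNumber_circleLift_le hlam hd (ρ := r) (α := α) ?_ ?_).trans_lt h3
  · linarith [ceilSeries_le_floorSeries hlam hd r 0 (-α)]
  · linarith [ceilSeries_le_floorSeries hlam hd r α 0]

theorem lt_translationNumber_circleLift {δ a ρ α : ℝ}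
    (h0 : 0 < (δ + d) / (1 - lam) + ceilSeries lam d ρ 0 (-α))
    (ha : a < (δ + d) / (1 - lam) + ceilSeries lam d ρ α 0) :
    ρ < (circleLift hlam hd δ a).translationNumber := by
  have hr : Tendsto (fun r : ℝ => r) (𝓝[>] ρ) (𝓝 ρ) := tendsto_id.mono_left nhdsWithin_le_nhds
  have hr' : ∀ᶠ r in 𝓝[>] ρ, ρ ≤ r := by
    filter_upwards [self_mem_nhdsWithin] with r hr using le_of_lt hr
  have lim : ∀ u v, Tendsto (fun r => (δ + d) / (1 - lam) + ceilSeries lam d r u v) (𝓝[>] ρ)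
      (𝓝 ((δ + d) / (1 - lam) + ceilSeries lam d ρ u v)) := fun u v =>
    (tendsto_ceilSeries_left hlam hd hr tendsto_const_nhds tendsto_const_nhds hr'
      (.of_forall fun _ => le_rfl) (.of_forall fun _ => le_rfl)).const_add _
  obtain ⟨r, ⟨h1, h2⟩, h3⟩ := (((lim 0 (-α)).eventually_const_lt h0).and
    ((lim α 0).eventually_const_lt ha) |>.and self_mem_nhdsWithin).exists
  refine lt_of_lt_of_le h3 (le_translationNumber_circleLift hlam hd (ρ := r) (α := α) ?_ ?_)
  · linarith [ceilSeries_le_floorSeries hlam hd r 0 (-α)]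
  · linarith [ceilSeries_le_floorSeries hlam hd r α 0]

/-! ### The regions in terms of the series -/

theorem deltaFun_eq (hlam : lam ∈ Ioo (0 : ℝ) 1) (ρ : ℝ) {α : ℝ} (hα : α ∈ Icc (0 : ℝ) 1) :
    deltaFun lam d ρ α = 1 - lam - d + (1 - lam) * floorSeries lam d (-ρ) 0 α := by
  have hl := hlam.1.ne'
  have h : ∑' k : ℕ, lam ^ (k + 1) * ((1 - lam) * (⌊((k + 1 : ℕ) : ℝ) * ρ⌋ : ℝ)
      + d * theta (1 - α) (Int.fract (((k + 1 : ℕ) : ℝ) * ρ))) =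
      lam * floorSeries lam d (-ρ) 0 α := by
    rw [floorSeries, ← tsum_mul_left]
    refine tsum_congr fun k => ?_
    have e := floor_add_theta hα (((k + 1 : ℕ) : ℝ) * ρ)
    have e1 : 0 - ((k + 1 : ℕ) : ℝ) * -ρ = ((k + 1 : ℕ) : ℝ) * ρ := by ring
    have e2 : α - ((k + 1 : ℕ) : ℝ) * -ρ = ((k + 1 : ℕ) : ℝ) * ρ + α := by ring
    rw [e1, e2, ← e]
    ring
  rw [deltaFun, h]
  field_simp

include hlam hd in
theorem aFun_eq (δ ρ : ℝ) {α : ℝ} (hα : α ∈ Icc (0 : ℝ) 1) :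
    aFun lam d δ ρ α = (δ + d) / (1 - lam) + floorSeries lam d ρ α 0 := by
  have hl := hlam.1.ne'
  have h : ∑' k : ℕ, lam ^ (k + 1) * ((1 - lam) * (⌊α - ((k + 1 : ℕ) : ℝ) * ρ⌋ : ℝ)
      + d * theta α (Int.fract (α - ((k + 1 : ℕ) : ℝ) * ρ))) =
      lam * floorSeries lam d ρ α 1 := by
    rw [floorSeries, ← tsum_mul_left]
    refine tsum_congr fun k => ?_
    have e := floor_add_theta (α := 1 - α) ⟨by linarith [hα.2], by linarith [hα.1]⟩
      (α - ((k + 1 : ℕ) : ℝ) * ρ)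
    have e1 : α - ((k + 1 : ℕ) : ℝ) * ρ + (1 - α) = 1 - ((k + 1 : ℕ) : ℝ) * ρ := by ring
    rw [e1, sub_sub_cancel] at e
    rw [← e]
    ring
  have h1 := floorSeries_add_int hlam hd ρ α 0 0 1
  simp only [Int.cast_zero, Int.cast_one, add_zero, zero_add, mul_zero, mul_one] at h1
  rw [aFun, h, h1]
  field_simp
  ring

include hlam hd in
theorem leftLim_deltaFun (ρ : ℝ) {α : ℝ} (hα : α ∈ Icc (0 : ℝ) 1) :
    Function.leftLim (fun r => deltaFun lam d r α) ρ =
      1 - lam - d + (1 - lam) * ceilSeries lam d (-ρ) 0 α := by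
  refine leftLim_eq_of_tendsto ?_
  simp only [deltaFun_eq hlam _ hα]
  exact (((tendsto_floorSeries_nhdsGT hlam hd (-ρ) 0 α).comp
    tendsto_neg_nhdsLT).const_mul _).const_add _

include hlam hd in
theorem rightLim_aFun (δ ρ : ℝ) {α : ℝ} (hα : α ∈ Icc (0 : ℝ) 1) :
    Function.rightLim (fun r => aFun lam d δ r α) ρ =
      (δ + d) / (1 - lam) + ceilSeries lam d ρ α 0 := by
  refine rightLim_eq_of_tendsto ?_
  simp only [aFun_eq hlam hd _ _ hα]
  exact (tendsto_floorSeries_nhdsGT hlam hd ρ α 0).const_add _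

include hlam hd in
theorem mem_region_iff (δ a ρ : ℝ) {α : ℝ} (hα : α ∈ Icc (0 : ℝ) 1) :
    (δ, a) ∈ region lam d ρ α ↔
      (0 ≤ (δ + d) / (1 - lam) + floorSeries lam d ρ 0 (-α) ∧
        (δ + d) / (1 - lam) + ceilSeries lam d ρ 0 (-α) ≤ 0) ∧
      ((δ + d) / (1 - lam) + ceilSeries lam d ρ α 0 ≤ a ∧
        a ≤ (δ + d) / (1 - lam) + floorSeries lam d ρ α 0) := by
  have hl : 0 < 1 - lam := sub_pos.2 hlam.2
  have hc : (1 - lam) * ((δ + d) / (1 - lam)) = δ + d := mul_div_cancel₀ _ hl.ne'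
  simp only [region, mem_ofPred_eq, mem_Icc, leftLim_deltaFun hlam hd ρ hα, deltaFun_eq hlam ρ hα,
    rightLim_aFun hlam hd δ ρ hα, aFun_eq hlam hd δ ρ hα]
  refine and_congr_left fun _ => and_congr ?_ ?_
  · rw [ceilSeries, neg_neg, neg_zero, ← mul_nonneg_iff_of_pos_left hl, mul_add, hc]
    constructor <;> intro h <;> linarith
  · rw [ceilSeries, neg_neg, neg_zero, ← neg_nonneg, ← mul_nonneg_iff_of_pos_left hl, mul_neg,
      mul_add, hc]
    constructor <;> intro h <;> linarith

/-! ### Existence of the parameter `α` -/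

/-- Each of the four inequalities that define the regions holds on a subinterval of `[0, 1]` in the
variable `α`, and `α` is taken to be the largest point at which the two inequalities that survive a
decrease of `α` hold. If one of the other two failed there, then strict inequalities would show that
the rotation number is not `ρ`. -/
theorem exists_mem_region {δ a ρ : ℝ} (ha : a ∈ Icc (0 : ℝ) 1)
    (hτ : (circleLift hlam hd δ a).translationNumber = ρ) :
    ∃ α ∈ Icc (0 : ℝ) 1, (δ, a) ∈ region lam d ρ α := by
  set c := (δ + d) / (1 - lam) with hc
  have le_floor : ∀ α, c + floorSeries lam d ρ 0 (-α) < 0 → a ≤ c + floorSeries lam d ρ α 0 :=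
    fun α h => not_lt.1 fun h' => (translationNumber_circleLift_lt hlam hd h h').ne hτ
  have ceil_le : ∀ α, a < c + ceilSeries lam d ρ α 0 → c + ceilSeries lam d ρ 0 (-α) ≤ 0 :=
    fun α h => not_lt.1 fun h' => (lt_translationNumber_circleLift hlam hd h' h).ne' hτ
  set S : Set ℝ := {α | α ∈ Icc (0 : ℝ) 1 ∧ 0 ≤ c + floorSeries lam d ρ 0 (-α) ∧
    c + ceilSeries lam d ρ α 0 ≤ a} with hS
  have zero_mem : (0 : ℝ) ∈ S := by
    refine ⟨by simp, not_lt.1 fun h => ?_, not_lt.1 fun h => ?_⟩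
    · have := le_floor 0 h
      rw [neg_zero] at h
      linarith [ha.1]
    · have := ceil_le 0 h
      rw [neg_zero] at this
      linarith [ha.1]
  have bdd : BddAbove S := ⟨1, fun α h => h.1.2⟩
  have hlub := isLUB_csSup ⟨0, zero_mem⟩ bdd
  set s := sSup S
  have s_mem : s ∈ S := by
    have hle : ∀ᶠ α in 𝓝[S] s, α ≤ s := by
      filter_upwards [self_mem_nhdsWithin] with α hα using hlub.1 hα
    have hid : Tendsto (fun α : ℝ => α) (𝓝[S] s) (𝓝 s) := tendsto_id.mono_left nhdsWithin_le_nhds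
    have := hlub.nhdsWithin_neBot ⟨0, zero_mem⟩
    refine ⟨⟨hlub.1 zero_mem, hlub.2 fun α h => h.1.2⟩, ?_, ?_⟩
    · refine ge_of_tendsto ((tendsto_floorSeries_right hlam hd (l := 𝓝[S] s) (r := fun _ => ρ)
        (u := fun _ => 0) tendsto_const_nhds tendsto_const_nhds hid.neg
        (.of_forall fun _ => le_rfl) (.of_forall fun _ => le_rfl)
        (hle.mono fun _ => neg_le_neg)).const_add c) ?_
      filter_upwards [self_mem_nhdsWithin] with α hα using hα.2.1
    · refine le_of_tendsto ((tendsto_ceilSeries_left hlam hd (l := 𝓝[S] s) (r := fun _ => ρ)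
        (v := fun _ => 0) tendsto_const_nhds hid tendsto_const_nhds
        (.of_forall fun _ => le_rfl) hle (.of_forall fun _ => le_rfl)).const_add c) ?_
      filter_upwards [self_mem_nhdsWithin] with α hα using hα.2.2
  have goal : c + ceilSeries lam d ρ 0 (-s) ≤ 0 ∧ a ≤ c + floorSeries lam d ρ s 0 := by
    rcases s_mem.1.2.eq_or_lt with h1 | h1
    · -- For `α = 1` periodicity gives `h α = h 0 + 1`, and `0 ≤ a ≤ 1`.
      have e1 := floorSeries_add_int_self hlam hd ρ 0 (-1) 1
      have e2 := ceilSeries_add_int_self hlam hd ρ 0 (-1) 1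
      norm_num at e1 e2
      rw [h1, e1]
      have f1 := le_floor 1
      have f2 := ceil_le 1
      rw [e1] at f1
      rw [e2] at f2
      refine ⟨not_lt.1 fun h => ?_, not_lt.1 fun h => ?_⟩
      · linarith [f2 (by linarith [ha.2])]
      · linarith [f1 (by linarith [ha.2])]
    · have hge : ∀ᶠ α in 𝓝[>] s, s ≤ α := by
        filter_upwards [self_mem_nhdsWithin] with α hα using le_of_lt hα
      have hid : Tendsto (fun α : ℝ => α) (𝓝[>] s) (𝓝 s) :=
        tendsto_id.mono_left nhdsWithin_le_nhds
      have lim1 := (tendsto_ceilSeries_left hlam hd (l := 𝓝[>] s) (r := fun _ => ρ)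
        (u := fun _ => 0) tendsto_const_nhds tendsto_const_nhds hid.neg
        (.of_forall fun _ => le_rfl) (.of_forall fun _ => le_rfl)
        (hge.mono fun _ => neg_le_neg)).const_add c
      have lim2 := (tendsto_floorSeries_right hlam hd (l := 𝓝[>] s) (r := fun _ => ρ)
        (v := fun _ => 0) tendsto_const_nhds hid tendsto_const_nhds
        (.of_forall fun _ => le_rfl) hge (.of_forall fun _ => le_rfl)).const_add c
      have not_mem : ∀ α ∈ Ioc s 1, c + floorSeries lam d ρ 0 (-α) < 0 ∨
          a < c + ceilSeries lam d ρ α 0 := fun α hα => by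
        by_contra! h
        exact hα.1.not_ge (hlub.1 ⟨⟨s_mem.1.1.trans hα.1.le, hα.2⟩, h⟩)
      have near : ∀ᶠ α in 𝓝[>] s, α ∈ Ioc s 1 := Ioc_mem_nhdsGT h1
      refine ⟨?_, ?_⟩
      · refine not_lt.1 fun h => ?_
        -- Points beyond `s` violate one of the conditions that define `S`; it is not the first,
        -- since the ceiling series, which is still positive there, bounds the floor series.
        obtain ⟨α, h2, h3⟩ := ((lim1.eventually_const_lt h).and near).exists
        rcases not_mem α h3 with h4 | h4
        · linarith [ceilSeries_le_floorSeries hlam hd ρ 0 (-α)]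
        · linarith [ceil_le α h4]
      · refine not_lt.1 fun h => ?_
        obtain ⟨α, h2, h3⟩ := ((lim2.eventually_lt_const h).and near).exists
        rcases not_mem α h3 with h4 | h4
        · linarith [le_floor α h4]
        · linarith [ceilSeries_le_floorSeries hlam hd ρ α 0]
  exact ⟨s, s_mem.1, (mem_region_iff hlam hd δ a ρ s_mem.1).2
    ⟨⟨s_mem.2.1, goal.1⟩, s_mem.2.2, goal.2⟩⟩

end PWContraction

theorem corollary4 (lam d : ℝ) (hlam : lam ∈ Set.Ioo (0 : ℝ) 1)
    (hd : d ∈ Set.Ioo (0 : ℝ) (1 - lam)) :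
    (∀ δ ∈ Set.Ioo (1 - lam - d) 1, ∀ a ∈ Set.Icc (0 : ℝ) 1,
      ∃! ρ : ℝ, PWContraction.HasRotationNumber (PWContraction.f lam d δ a) ρ) ∧
    (∀ δ ∈ Set.Ioo (1 - lam - d) 1, ∀ a ∈ Set.Icc (0 : ℝ) 1, ∀ ρ ∈ Set.Ioo (0 : ℝ) 1,
      (PWContraction.HasRotationNumber (PWContraction.f lam d δ a) ρ ↔
        (δ, a) ∈ ⋃ α ∈ Set.Icc (0 : ℝ) 1, PWContraction.region lam d ρ α)) ∧
    MeasureTheory.NullMeasurableSet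
      {p : ℝ × ℝ | p ∈ Set.Ioo (1 - lam - d) 1 ×ˢ Set.Icc (0 : ℝ) 1 ∧
        ∃ ρ : ℝ, Irrational ρ ∧
          PWContraction.HasRotationNumber (PWContraction.f lam d p.1 p.2) ρ}
      MeasureTheory.volume := by
  open PWContraction in
  refine ⟨fun δ _ a ha => ?_, fun δ hδ a ha ρ hρ => ?_, ?_⟩
  · exact ⟨_, (hasRotationNumber_iff (hlam := hlam) (hd := hd) ha δ _).2 rfl,
      fun ρ h => ((hasRotationNumber_iff ha δ ρ).1 h).symm⟩
  · rw [hasRotationNumber_iff (hlam := hlam) (hd := hd) ha]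
    simp only [mem_iUnion, exists_prop]
    constructor
    · intro h
      have hmem := translationNumber_circleLift_mem_Icc (hlam := hlam) (hd := hd) hδ ha
      rcases hmem.2.eq_or_lt with h1 | h1
      · -- Translation number `1` means rotation number `0`.
        rw [h1, Int.fract_one] at h
        exact absurd h hρ.1.ne
      · rw [Int.fract_eq_self.2 ⟨hmem.1, h1⟩] at h
        exact exists_mem_region hlam hd ha h
    · rintro ⟨α, hα, h⟩
      rw [mem_region_iff hlam hd δ a ρ hα] at h
      rw [le_antisymm (translationNumber_circleLift_le hlam hd h.1.2 h.2.1)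
        (le_translationNumber_circleLift hlam hd h.1.1 h.2.2)]
      exact Int.fract_eq_self.2 ⟨hρ.1.le, hρ.2⟩
  · have hirr : MeasurableSet {x : ℝ | Irrational x} :=
      (countable_range ((↑) : ℚ → ℝ)).measurableSet.compl
    have hm := (measurableSet_Ioo (a := 1 - lam - d) (b := (1 : ℝ))).prod
      (measurableSet_Icc (a := (0 : ℝ)) (b := 1)) |>.inter
      ((measurable_translationNumber_circleLift (hlam := hlam) (hd := hd)).fract hirr)
    refine (congrArg (NullMeasurableSet · volume) (Set.ext fun p => ?_)).mp hm.nullMeasurableSet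
    refine and_congr_right fun hp => ?_
    simp only [hasRotationNumber_iff (hlam := hlam) (hd := hd) hp.2]
    simp
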